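/- Theorem 1.3. Let $T$ be a (finite, simplicial) triangulation of a closed surface $M$ with vertex set $V=\{v_1,\dots,v_N\}$, edge set $E$ and set of triangles $F$. A PL metric associated to $T$ is a function $d:E\to\mathbb R_{>0}$, $d_{ij}=d(v_iv_j)$, satisfying the strict triangle inequalities on the three edges of every triangle of $T$; its curvature at $v_i$ is $K_i=2\pi-\sum\theta_i^{jk}$, where the sum is over all triangles $v_iv_jv_k$ of $T$ at $v_i$ and $\theta_i^{jk}$ is the inner angle at $v_i$ of the Euclidean triangle with the edge lengths given by $d$. For $u=(u_1,\dots,u_N)\in\mathbb R_{>0}^N$ put $(u*d)(v_iv_j)=u_iu_jd_{ij}$, and let $K_{av}=2\pi\chi(M)/N$. Given a PL metric $d$, a solution of the normalized combinatorial Yamabe flow on $[0,L)$, $0<L\le\infty$, is a differentiable $u:[0,L)\to\mathbb R_{>0}^N$ such that $u(t)*d$ is a PL metric for every $t\in[0,L)$ and $$\frac{du_i}{dt}=-u_i\,(K_i-K_{av}),\qquad u_i(0)=1,\qquad i=1,\dots,N,$$ where $K_i$ is the curvature at $v_i$ of $u(t)*d$. It develops an essential singularity at time $L$ if there are an index $i$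 and times $t_n\in[0,L)$ with $t_n\to L$ and $u_i(t_n)\to 0$. The triangulation $T$ is called admissible if some PL metric associated to $T$ has the same curvature at all vertices. (a) For every triangulation $T$ of a closed surface, every PL metric $d$ associated to $T$ and every $L<\infty$, no solution of the normalized combinatorial Yamabe flow on $[0,L)$ develops an essential singularity at time $L$. (b) If $T$ is admissible, then for every PL metric $d$ associated to $T$, no solution of the normalized combinatorial Yamabe flow on $[0,\infty)$ develops an essential singularity at time $L=\infty$. -/

import Mathlib

/-!
# The normalized combinatorial Yamabe flow on a triangulated closed surface

A triangulation of a closed surface is a finite abstract simplicial complex in which the link of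
every vertex is a cycle. Its vertices are the elements of `V`, an edge `v w` is the two-element
face `{v, w}`, and a triangle is a three-element face.

A length function is a map `d : Finset V → ℝ`, of which only the values on the edges of the
triangulation are ever used. For a vertex `i` of a triangle `t`, the edge of `t` opposite to `i`
is `t.erase i`.
-/

noncomputable section

namespace Yamabe

variable {V : Type*} [Fintype V] [DecidableEq V]

/-- The link of the vertex `v`, as a graph: its vertices are the neighbours of `v`, and two of
them are joined when together with `v` they span a triangle. -/
def link (T : AbstractSimplicialComplex V) (v : V) :
    SimpleGraph {w : V // w ≠ v ∧ ({v, w} : Finset V) ∈ T} where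
  Adj a b := a ≠ b ∧ ({v, a.1, b.1} : Finset V) ∈ T
  symm := ⟨fun a b h => ⟨h.1.symm, by
    have := h.2
    rwa [Finset.pair_comm] at this⟩⟩
  loopless := ⟨fun _ h => h.1 rfl⟩

/-- `T` triangulates a closed surface: simplices have dimension at most two, and
the link of every vertex is a cycle (a simplicial circle). -/
structure IsClosedSurface (T : AbstractSimplicialComplex V) : Prop where
  card_le_three : ∀ s ∈ T, s.card ≤ 3
  link_isCycle : ∀ v : V, ∃ n : ℕ, 3 ≤ n ∧ Nonempty (link T v ≃g SimpleGraph.cycleGraph n)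

open scoped Classical in
/-- The set of edges of the triangulation. -/
def edges (T : AbstractSimplicialComplex V) : Finset (Finset V) :=
  Finset.univ.filter fun s => s ∈ T ∧ s.card = 2

open scoped Classical in
/-- The set of triangles of the triangulation. -/
def triangles (T : AbstractSimplicialComplex V) : Finset (Finset V) :=
  Finset.univ.filter fun s => s ∈ T ∧ s.card = 3

/-- The Euler characteristic `|V| - |E| + |F|` of the triangulated surface. -/
def eulerChar (T : AbstractSimplicialComplex V) : ℤ :=
  (Fintype.card V : ℤ) - ((edges T).card : ℤ) + ((triangles T).card : ℤ)

/-- `d` is a PL metric associated to `T`: it is positive on the edges, and the three edges of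
every triangle satisfy the strict triangle inequalities. -/
structure IsPLMetric (T : AbstractSimplicialComplex V) (d : Finset V → ℝ) : Prop where
  pos : ∀ e ∈ edges T, 0 < d e
  triangle_lt : ∀ t ∈ triangles T, ∀ i ∈ t, d (t.erase i) < ∑ j ∈ t.erase i, d (t.erase j)

/-- The PL conformal change `u * d`, given on an edge `v w` by `u v * u w * d (v w)`. -/
def conformal (u : V → ℝ) (d : Finset V → ℝ) : Finset V → ℝ :=
  fun e => (∏ v ∈ e, u v) * d e

/-- The inner angle at the vertex `i` of the Euclidean triangle `t = {i, j, k}` with edge lengths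
given by `d`. With `x r` the length of the edge opposite to `r`, it is the angle in `[0, π]` whose
cosine is `(x j ^ 2 + x k ^ 2 - x i ^ 2) / (2 * x j * x k)`. -/
def innerAngle (d : Finset V → ℝ) (t : Finset V) (i : V) : ℝ :=
  Real.arccos (((∑ j ∈ t.erase i, d (t.erase j) ^ 2) - d (t.erase i) ^ 2) /
    (2 * ∏ j ∈ t.erase i, d (t.erase j)))

/-- The curvature at the vertex `i`: `2π` minus the sum of the inner angles at `i` over all
triangles having `i` as a vertex. -/
def curvature (T : AbstractSimplicialComplex V) (d : Finset V → ℝ) (i : V) : ℝ :=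
  2 * Real.pi - ∑ t ∈ (triangles T).filter (fun t => i ∈ t), innerAngle d t i

/-- The average curvature `2π χ(M) / |V|`. -/
def averageCurvature (T : AbstractSimplicialComplex V) : ℝ :=
  2 * Real.pi * (eulerChar T : ℝ) / (Fintype.card V : ℝ)

/-- A triangulation is admissible if it supports a PL metric of constant curvature. -/
def IsAdmissible (T : AbstractSimplicialComplex V) : Prop :=
  ∃ d : Finset V → ℝ, IsPLMetric T d ∧ ∃ c : ℝ, ∀ i : V, curvature T d i = c

/-- `u` is a solution on the time interval `[0, L)`, with `L ≤ ∞`, of the normalized combinatorial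
Yamabe flow `u i' = - u i * (K i - K_av)`, `u i 0 = 1`, with initial PL metric `d`. At every time
`u` is a conformal factor, that is, it is positive and `u * d` is a PL metric. (The derivative at
time `0` is one-sided.) -/
structure IsNormalizedFlow (T : AbstractSimplicialComplex V) (d : Finset V → ℝ) (L : EReal)
    (u : ℝ → V → ℝ) : Prop where
  initial : ∀ i : V, u 0 i = 1
  pos : ∀ t : ℝ, 0 ≤ t → (t : EReal) < L → ∀ i : V, 0 < u t i
  isPLMetric : ∀ t : ℝ, 0 ≤ t → (t : EReal) < L → IsPLMetric T (conformal (u t) d)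
  hasDeriv : ∀ t : ℝ, 0 ≤ t → (t : EReal) < L → ∀ i : V,
    HasDerivWithinAt (fun s => u s i)
      (-(u t i) * (curvature T (conformal (u t) d) i - averageCurvature T)) (Set.Ici 0) t

/-- `u`, defined on `[0, L)`, develops an essential singularity at time `L ≤ ∞`: for some vertex
`i` there are times `τ n` in `[0, L)` approaching `L` along which `u i` tends to `0`. -/
def DevelopsEssentialSingularity (u : ℝ → V → ℝ) (L : EReal) : Prop :=
  ∃ i : V, ∃ τ : ℕ → ℝ, (∀ n, 0 ≤ τ n ∧ (τ n : EReal) < L) ∧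
    Filter.Tendsto (fun n => (τ n : EReal)) Filter.atTop (nhds L) ∧
    Filter.Tendsto (fun n => u (τ n) i) Filter.atTop (nhds 0)

end Yamabe

end

noncomputable section

namespace Yamabe

open Filter Topology

set_option linter.unusedSectionVars false

variable {V : Type*} [Fintype V] [DecidableEq V]

/-! ### Combinatorics of triangulated surfaces -/

/-! Along the flow, `log u_i` has derivative `K_av - K_i`. Since angles are nonnegative, `K_i ≤ 2π`,
so `log u_i` decreases at most linearly, which gives (a).

For (b), consider sums over vertex sets `I`. In a triangle the angles at `I` add up to `π` minus
those off `I`, so every PL metric has total curvature on `I` above `degenerateCurvature T I`,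
strictly if some triangle straddles `I`. The constant curvature metric then gives
`degenerateCurvature T I < |I| K_av`. Conversely, if `u` is much smaller on `I` than off it, the
angles off `I` in triangles meeting `I` are tiny, so the total curvature of `I` falls below `|I|
K_av` and `∑_I log u` is increasing.

These facts combine by a barrier argument: minimize `∑_I log u(s) - b(|I|)` over all `I` and all
times `s ≤ t`, with `b` strictly convex. Convexity forces a gap between `I` and its complement at a
minimizer, so the sum is increasing there, contradicting minimality. If no triangle straddles `I`,
the sum is constant. -/

theorem mem_edges {T : AbstractSimplicialComplex V} {s : Finset V} :
    s ∈ edges T ↔ s ∈ T ∧ s.card = 2 := by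
  simp [edges]

theorem mem_triangles {T : AbstractSimplicialComplex V} {s : Finset V} :
    s ∈ triangles T ↔ s ∈ T ∧ s.card = 3 := by
  simp [triangles]

theorem face_of_subset {T : AbstractSimplicialComplex V} {s t : Finset V} (ht : t ∈ T)
    (hst : s ⊆ t) (hs : s.Nonempty) : s ∈ T :=
  (T.isRelLowerSet_faces ht).2 hst hs

theorem edge_of_subset_triangle {T : AbstractSimplicialComplex V} {s t : Finset V}
    (ht : t ∈ triangles T) (hst : s ⊆ t) (hs : s.card = 2) : s ∈ edges T :=
  mem_edges.2 ⟨face_of_subset (mem_triangles.1 ht).1 hst (Finset.card_pos.1 (by omega)), hs⟩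

/-- Triangles through `{v, w}` correspond to neighbours of `w` in the link of `v`, a cycle. -/
theorem card_triangles_containing_edge {T : AbstractSimplicialComplex V} (hT : IsClosedSurface T)
    {e : Finset V} (he : e ∈ edges T) : ((triangles T).filter fun t => e ⊆ t).card = 2 := by
  classical
  obtain ⟨heT, hcard⟩ := mem_edges.1 he
  obtain ⟨v, w, hvw, rfl⟩ := Finset.card_eq_two.1 hcard
  obtain ⟨n, hn, ⟨φ⟩⟩ := hT.link_isCycle v
  obtain ⟨m, rfl⟩ : ∃ m, n = m + 3 := ⟨n - 3, by omega⟩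
  let w' : {x : V // x ≠ v ∧ ({v, x} : Finset V) ∈ T} := ⟨w, hvw.symm, heT⟩
  have hdeg : (link T v).degree w' = 2 := by
    rw [← φ.degree_eq, SimpleGraph.cycleGraph_degree_three_le]
  have himage : (triangles T).filter (fun t => {v, w} ⊆ t) =
      ((link T v).neighborFinset w').image fun a => {v, w, a.1} := by
    ext t
    simp only [Finset.mem_filter, mem_triangles, Finset.mem_image, SimpleGraph.mem_neighborFinset]
    constructor
    · rintro ⟨⟨htT, ht3⟩, hsub⟩
      have h1 : (t \ {v, w}).card = 1 := by
        rw [Finset.card_sdiff_of_subset hsub, ht3, hcard]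
      obtain ⟨a, ha⟩ := Finset.card_eq_one.1 h1
      have hat : a ∈ t \ {v, w} := by simp [ha]
      simp only [Finset.mem_sdiff, Finset.mem_insert, Finset.mem_singleton, not_or] at hat
      have ht : {v, w, a} = t := by
        rw [← Finset.union_sdiff_of_subset hsub, ha]
        ext; simp
      refine ⟨⟨a, hat.2.1, face_of_subset htT ?_ (by simp)⟩, ⟨?_, ?_⟩, ht⟩
      · rw [← ht]; intro; simp; tauto
      · intro h
        exact hat.2.2 (congrArg Subtype.val h).symm
      · rw [ht]; exact htT
    · rintro ⟨a, ⟨hne, ha⟩, rfl⟩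
      refine ⟨⟨ha, Finset.card_eq_three.2 ⟨v, w, a.1, hvw, a.2.1.symm, ?_, rfl⟩⟩, ?_⟩
      · exact fun h => hne (Subtype.ext h)
      · intro; simp; tauto
  rw [himage, Finset.card_image_of_injOn, SimpleGraph.card_neighborFinset_eq_degree, hdeg]
  intro a ha b _ hab
  have hmem : a.1 ∈ ({v, w, b.1} : Finset V) := by
    rw [← show ({v, w, a.1} : Finset V) = {v, w, b.1} from hab]; simp
  have haw : w ≠ a.1 := fun h =>
    ((SimpleGraph.mem_neighborFinset _ _ _).1 ha).1 (Subtype.ext h)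
  simp only [Finset.mem_insert, Finset.mem_singleton] at hmem
  rcases hmem with h | h | h
  · exact absurd h a.2.1
  · exact absurd h.symm haw
  · exact Subtype.ext h

theorem two_mul_card_edges {T : AbstractSimplicialComplex V} (hT : IsClosedSurface T) :
    (edges T).card * 2 = (triangles T).card * 3 := by
  classical
  refine Finset.card_mul_eq_card_mul (fun e t => e ⊆ t)
    (fun e he => by
      rw [← card_triangles_containing_edge hT he]
      congr) fun t ht => ?_
  have : (edges T).bipartiteBelow (fun e t => e ⊆ t) t = t.powersetCard 2 := by
    ext e
    simp only [Finset.mem_bipartiteBelow, Finset.mem_powersetCard]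
    exact ⟨fun h => ⟨h.2, (mem_edges.1 h.1).2⟩,
      fun h => ⟨edge_of_subset_triangle ht h.1 h.2, h.1⟩⟩
  rw [this, Finset.card_powersetCard, (mem_triangles.1 ht).2]
  rfl

/-- From `2|E| = 3|F|`, the Euler characteristic is `|V| - |F|/2`. -/
theorem card_mul_averageCurvature [Nonempty V] {T : AbstractSimplicialComplex V}
    (hT : IsClosedSurface T) :
    (Fintype.card V : ℝ) * averageCurvature T =
      2 * Real.pi * Fintype.card V - Real.pi * (triangles T).card := by
  have h : ((edges T).card : ℝ) * 2 = (triangles T).card * 3 := by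
    exact_mod_cast two_mul_card_edges hT
  have hV : (Fintype.card V : ℝ) ≠ 0 := by simp
  rw [averageCurvature, eulerChar]
  push_cast
  field_simp
  linear_combination -h

/-! ### Euclidean triangles -/

theorem cosine_mem_Ioo {a b c : ℝ} (hb : 0 < b) (hc : 0 < c)
    (h1 : a < b + c) (h2 : b < a + c) (h3 : c < a + b) :
    (b ^ 2 + c ^ 2 - a ^ 2) / (2 * (b * c)) ∈ Set.Ioo (-1 : ℝ) 1 := by
  have hbc : 0 < 2 * (b * c) := by positivity
  constructor
  · rw [lt_div_iff₀ hbc]; nlinarith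
  · rw [div_lt_iff₀ hbc]; nlinarith

theorem sin_arccos_cosine {a b c : ℝ} (hb : 0 < b) (hc : 0 < c) :
    Real.sin (Real.arccos ((b ^ 2 + c ^ 2 - a ^ 2) / (2 * (b * c)))) =
      √((a + b + c) * (b + c - a) * (a + c - b) * (a + b - c)) / (2 * (b * c)) := by
  have hbc : 0 ≤ 2 * (b * c) := by positivity
  rw [Real.sin_arccos, ← Real.sqrt_sq hbc, ← Real.sqrt_div' _ (sq_nonneg _), Real.sqrt_sq hbc]
  congr 1
  field_simp
  ring

theorem arccos_add_arccos_add_arccos_eq_pi {a b c : ℝ} (ha : 0 < a) (hb : 0 < b) (hc : 0 < c)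
    (h1 : a < b + c) (h2 : b < a + c) (h3 : c < a + b) :
    Real.arccos ((b ^ 2 + c ^ 2 - a ^ 2) / (2 * (b * c))) +
      Real.arccos ((a ^ 2 + c ^ 2 - b ^ 2) / (2 * (a * c))) +
      Real.arccos ((a ^ 2 + b ^ 2 - c ^ 2) / (2 * (a * b))) = Real.pi := by
  have hA := cosine_mem_Ioo hb hc h1 h2 h3
  have hB := cosine_mem_Ioo ha hc h2 h1 (by linarith : c < b + a)
  have hC := cosine_mem_Ioo ha hb h3 (by linarith : a < c + b) (by linarith : b < c + a)
  have sA := sin_arccos_cosine (a := a) hb hc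
  have sB := sin_arccos_cosine (a := b) ha hc
  have sC := sin_arccos_cosine (a := c) ha hb
  have cA := Real.cos_arccos hA.1.le hA.2.le
  have cB := Real.cos_arccos hB.1.le hB.2.le
  have cC := Real.cos_arccos hC.1.le hC.2.le
  -- Heron's radicand is symmetric, so all three sines share one square root `S`.
  have hS : (b + a + c) * (a + c - b) * (b + c - a) * (b + a - c) =
      (a + b + c) * (b + c - a) * (a + c - b) * (a + b - c) := by ring
  have hS' : (c + a + b) * (a + b - c) * (c + b - a) * (c + a - b) =
      (a + b + c) * (b + c - a) * (a + c - b) * (a + b - c) := by ring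
  rw [hS] at sB
  rw [hS'] at sC
  have hpos : 0 < (a + b + c) * (b + c - a) * (a + c - b) * (a + b - c) := by
    have := sub_pos.2 h1; have := sub_pos.2 h2; have := sub_pos.2 h3
    positivity
  have hsq := Real.sq_sqrt hpos.le
  have hspos := Real.sqrt_pos.2 hpos
  set S := √((a + b + c) * (b + c - a) * (a + c - b) * (a + b - c))
  have A0 := Real.arccos_pos.2 hA.2
  have B0 := Real.arccos_pos.2 hB.2
  have A1 := Real.arccos_lt_pi.2 hA.1
  have B1 := Real.arccos_lt_pi.2 hB.1
  set α := Real.arccos ((b ^ 2 + c ^ 2 - a ^ 2) / (2 * (b * c)))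
  set β := Real.arccos ((a ^ 2 + c ^ 2 - b ^ 2) / (2 * (a * c)))
  set γ := Real.arccos ((a ^ 2 + b ^ 2 - c ^ 2) / (2 * (a * b))) with hγ
  have hcos : Real.cos (α + β) = Real.cos (Real.pi - γ) := by
    rw [Real.cos_add, Real.cos_pi_sub, cA, cB, cC, sA, sB]
    field_simp
    linear_combination -hsq
  have hsin : 0 < Real.sin (α + β) := by
    have : Real.sin (α + β) = S / (2 * (a * b)) := by
      rw [Real.sin_add, cA, cB, sA, sB]
      field_simp
      ring
    rw [this]
    positivity
  -- The positive sine puts `α + β` in `[0, π]`, where the cosine is injective.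
  have hlt : α + β ≤ Real.pi := by
    by_contra! h
    have h' := Real.sin_pos_of_pos_of_lt_pi (x := α + β - Real.pi) (by linarith) (by linarith)
    rw [Real.sin_sub_pi] at h'
    linarith
  have := Real.injOn_cos ⟨by linarith, hlt⟩
    ⟨sub_nonneg.2 (Real.arccos_le_pi _), sub_le_self _ (Real.arccos_nonneg _)⟩ hcos
  linarith

theorem innerAngle_nonneg (d : Finset V → ℝ) (t : Finset V) (i : V) : 0 ≤ innerAngle d t i :=
  Real.arccos_nonneg _

theorem innerAngle_eq (d : Finset V → ℝ) {i j k : V} (hij : i ≠ j) (hik : i ≠ k) (hjk : j ≠ k) :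
    innerAngle d {i, j, k} i =
      Real.arccos ((d {i, k} ^ 2 + d {i, j} ^ 2 - d {j, k} ^ 2) / (2 * (d {i, k} * d {i, j}))) := by
  have e1 : ({i, j, k} : Finset V).erase i = {j, k} := by grind
  have e2 : ({i, j, k} : Finset V).erase j = {i, k} := by grind
  have e3 : ({i, j, k} : Finset V).erase k = {i, j} := by grind
  simp only [innerAngle, e1, Finset.sum_pair hjk, Finset.prod_pair hjk, e2, e3]

theorem IsPLMetric.side_pos {T : AbstractSimplicialComplex V} {d : Finset V → ℝ}
    (hd : IsPLMetric T d) {t : Finset V} (ht : t ∈ triangles T) {i j : V} (hi : i ∈ t)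
    (hj : j ∈ t) (hij : i ≠ j) : 0 < d {i, j} :=
  hd.pos _ (edge_of_subset_triangle ht (by intro; simp; rintro (rfl | rfl) <;> assumption)
    (Finset.card_pair hij))

theorem IsPLMetric.side_lt {T : AbstractSimplicialComplex V} {d : Finset V → ℝ}
    (hd : IsPLMetric T d) {i j k : V} (ht : {i, j, k} ∈ triangles T)
    (hij : i ≠ j) (hik : i ≠ k) (hjk : j ≠ k) : d {j, k} < d {i, k} + d {i, j} := by
  have e1 : ({i, j, k} : Finset V).erase i = {j, k} := by grind
  have e2 : ({i, j, k} : Finset V).erase j = {i, k} := by grind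
  have e3 : ({i, j, k} : Finset V).erase k = {i, j} := by grind
  have := hd.triangle_lt _ ht i (by simp)
  rwa [e1, Finset.sum_pair hjk, e2, e3] at this

theorem exists_eq_triangle {t : Finset V} (ht : t.card = 3) {i k : V} (hi : i ∈ t) (hk : k ∈ t)
    (hik : i ≠ k) : ∃ j, i ≠ j ∧ j ≠ k ∧ t = {i, j, k} := by
  have h1 : (t \ {i, k}).card = 1 := by
    rw [Finset.card_sdiff_of_subset (by grind), ht, Finset.card_pair hik]
  obtain ⟨j, hj⟩ := Finset.card_eq_one.1 h1
  have hjt : j ∈ t \ {i, k} := by simp [hj]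
  simp only [Finset.mem_sdiff, Finset.mem_insert, Finset.mem_singleton, not_or] at hjt
  refine ⟨j, Ne.symm hjt.2.1, hjt.2.2, ?_⟩
  rw [← Finset.union_sdiff_of_subset (show {i, k} ⊆ t by grind), hj]
  grind

theorem IsPLMetric.innerAngle_pos {T : AbstractSimplicialComplex V} {d : Finset V → ℝ}
    (hd : IsPLMetric T d) {t : Finset V} (ht : t ∈ triangles T) {i : V} (hi : i ∈ t) :
    0 < innerAngle d t i := by
  have h3 := (mem_triangles.1 ht).2
  obtain ⟨k, hk, hki⟩ := Finset.exists_mem_ne (by omega : 1 < t.card) i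
  obtain ⟨j, hij, hjk, rfl⟩ := exists_eq_triangle h3 hi hk hki.symm
  have e2 : ({j, i, k} : Finset V) = {i, j, k} := by grind
  have e3 : ({k, i, j} : Finset V) = {i, j, k} := by grind
  have s1 := hd.side_lt ht hij hki.symm hjk
  have s2 := hd.side_lt (e2 ▸ ht) hij.symm hjk hki.symm
  have s3 := hd.side_lt (e3 ▸ ht) hki hjk.symm hij
  rw [Finset.pair_comm j i] at s2
  rw [Finset.pair_comm k j, Finset.pair_comm k i] at s3
  rw [innerAngle_eq d hij hki.symm hjk, Real.arccos_pos]
  exact (cosine_mem_Ioo (hd.side_pos ht (by simp) (by simp) hki.symm)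
    (hd.side_pos ht (by simp) (by simp) hij) s1 s2 (by linarith)).2

theorem IsPLMetric.sum_innerAngle {T : AbstractSimplicialComplex V} {d : Finset V → ℝ}
    (hd : IsPLMetric T d) {t : Finset V} (ht : t ∈ triangles T) :
    ∑ i ∈ t, innerAngle d t i = Real.pi := by
  obtain ⟨i, j, k, hij, hik, hjk, rfl⟩ := Finset.card_eq_three.1 (mem_triangles.1 ht).2
  have e2 : ({i, j, k} : Finset V) = {j, i, k} := by grind
  have e3 : ({i, j, k} : Finset V) = {k, i, j} := by grind
  have s1 := hd.side_lt ht hij hik hjk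
  have s2 := hd.side_lt (e2 ▸ ht) hij.symm hjk hik
  have s3 := hd.side_lt (e3 ▸ ht) hik.symm hjk.symm hij
  have a2 : innerAngle d {i, j, k} j = _ := e2 ▸ innerAngle_eq d hij.symm hjk hik
  have a3 : innerAngle d {i, j, k} k = _ := e3 ▸ innerAngle_eq d hik.symm hjk.symm hij
  rw [Finset.pair_comm j i] at s2 a2
  rw [Finset.pair_comm k j, Finset.pair_comm k i] at s3 a3
  rw [Finset.sum_insert (by simp [hij, hik]), Finset.sum_pair hjk,
    innerAngle_eq d hij hik hjk, a2, a3]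
  have := arccos_add_arccos_add_arccos_eq_pi (hd.side_pos ht (by simp) (by simp) hjk)
    (hd.side_pos ht (by simp) (by simp) hik) (hd.side_pos ht (by simp) (by simp) hij)
    s1 (by linarith) (by linarith)
  linarith

/-! ### Sums of curvatures over sets of vertices -/

/-- The value `2π |I| - π |F_I|`, with `F_I` the set of triangles meeting `I`, towards which the
total curvature of `I` degenerates. -/
def degenerateCurvature (T : AbstractSimplicialComplex V) (I : Finset V) : ℝ :=
  2 * Real.pi * I.card - ∑ t ∈ triangles T, if (t ∩ I).Nonempty then Real.pi else 0

theorem sum_curvature (T : AbstractSimplicialComplex V) (d : Finset V → ℝ) (I : Finset V) :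
    ∑ i ∈ I, curvature T d i =
      2 * Real.pi * I.card - ∑ t ∈ triangles T, ∑ i ∈ t ∩ I, innerAngle d t i := by
  simp only [curvature, Finset.sum_sub_distrib, Finset.sum_const, nsmul_eq_mul]
  rw [mul_comm]
  congr 1
  refine Finset.sum_comm' fun i t => ?_
  simp only [Finset.mem_filter, Finset.mem_inter]
  tauto

theorem IsPLMetric.sum_inter_innerAngle {T : AbstractSimplicialComplex V} {d : Finset V → ℝ}
    (hd : IsPLMetric T d) {t : Finset V} (ht : t ∈ triangles T) (I : Finset V) :
    ∑ i ∈ t ∩ I, innerAngle d t i = Real.pi - ∑ i ∈ t \ I, innerAngle d t i := by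
  rw [← hd.sum_innerAngle ht, ← Finset.sum_inter_add_sum_sdiff t I, add_sub_cancel_right]

theorem IsPLMetric.sum_inter_innerAngle_le {T : AbstractSimplicialComplex V} {d : Finset V → ℝ}
    (hd : IsPLMetric T d) {t : Finset V} (ht : t ∈ triangles T) (I : Finset V) :
    ∑ i ∈ t ∩ I, innerAngle d t i ≤ if (t ∩ I).Nonempty then Real.pi else 0 := by
  split_ifs with h
  · rw [hd.sum_inter_innerAngle ht]
    exact sub_le_self _ (Finset.sum_nonneg fun i _ => innerAngle_nonneg _ _ _)
  · simp [Finset.not_nonempty_iff_eq_empty.1 h]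

theorem IsPLMetric.degenerateCurvature_lt {T : AbstractSimplicialComplex V} {d : Finset V → ℝ}
    (hd : IsPLMetric T d) {I : Finset V}
    (hI : ∃ t ∈ triangles T, (t ∩ I).Nonempty ∧ (t \ I).Nonempty) :
    degenerateCurvature T I < ∑ i ∈ I, curvature T d i := by
  obtain ⟨t, ht, h1, h2⟩ := hI
  rw [sum_curvature, degenerateCurvature]
  refine sub_lt_sub_left (Finset.sum_lt_sum (fun t ht => hd.sum_inter_innerAngle_le ht I)
    ⟨t, ht, ?_⟩) _
  rw [if_pos h1, hd.sum_inter_innerAngle ht]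
  exact sub_lt_self _ (Finset.sum_pos
    (fun i hi => hd.innerAngle_pos ht (Finset.mem_sdiff.1 hi).1) h2)

theorem IsPLMetric.sum_curvature_eq {T : AbstractSimplicialComplex V} {d : Finset V → ℝ}
    (hd : IsPLMetric T d) {I : Finset V}
    (hI : ¬ ∃ t ∈ triangles T, (t ∩ I).Nonempty ∧ (t \ I).Nonempty) :
    ∑ i ∈ I, curvature T d i = degenerateCurvature T I := by
  rw [sum_curvature, degenerateCurvature]
  congr 1
  refine Finset.sum_congr rfl fun t ht => ?_
  split_ifs with h
  · rw [hd.sum_inter_innerAngle ht, Finset.not_nonempty_iff_eq_empty.1 fun h' => hI ⟨t, ht, h, h'⟩]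
    simp
  · simp [Finset.not_nonempty_iff_eq_empty.1 h]

/-- Combinatorial Gauss–Bonnet: no triangle straddles the full vertex set. -/
theorem IsPLMetric.sum_curvature_univ {T : AbstractSimplicialComplex V} {d : Finset V → ℝ}
    (hT : IsClosedSurface T) (hd : IsPLMetric T d) :
    ∑ i, curvature T d i = Fintype.card V * averageCurvature T := by
  rcases isEmpty_or_nonempty V with hV | hV
  · simp
  rw [hd.sum_curvature_eq (by simp), degenerateCurvature, card_mul_averageCurvature hT]
  congr 1
  have : ∀ t ∈ triangles T, (if (t ∩ Finset.univ).Nonempty then Real.pi else 0) = Real.pi := by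
    intro t ht
    rw [Finset.inter_univ, if_pos (Finset.card_pos.1 (by have := (mem_triangles.1 ht).2; omega))]
  rw [Finset.sum_congr rfl this, Finset.sum_const, nsmul_eq_mul, mul_comm]

theorem IsPLMetric.curvature_eq_averageCurvature {T : AbstractSimplicialComplex V}
    {d : Finset V → ℝ} (hT : IsClosedSurface T) (hd : IsPLMetric T d) {c : ℝ}
    (hc : ∀ i, curvature T d i = c) (i : V) : curvature T d i = averageCurvature T := by
  have h := hd.sum_curvature_univ hT
  have hV : (Fintype.card V : ℝ) ≠ 0 := by
    have : Nonempty V := ⟨i⟩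
    simp
  simp only [hc, Finset.sum_const, nsmul_eq_mul, Finset.card_univ] at h
  rw [hc i, mul_left_cancel₀ hV h]

/-! ### Degeneration of conformal factors -/

theorem conformal_pair (w : V → ℝ) (d : Finset V → ℝ) {i j : V} (hij : i ≠ j) :
    conformal w d {i, j} = w i * w j * d {i, j} := by
  rw [conformal, Finset.prod_pair hij]

theorem eventually_arccos_lt (C : ℝ) {ε : ℝ} (hε : 0 < ε) :
    ∀ᶠ R : ℝ in atTop, Real.arccos (1 - C / R ^ 2) < ε := by
  have h : Tendsto (fun R : ℝ => Real.arccos (1 - C / R ^ 2)) atTop (𝓝 (Real.arccos (1 - 0))) :=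
    (Real.continuous_arccos.tendsto _).comp
      (tendsto_const_nhds.sub (tendsto_const_nhds.div_atTop (tendsto_pow_atTop two_ne_zero)))
  rw [sub_zero, Real.arccos_one] at h
  exact h.eventually_lt_const hε

/-- If the conformal factor is much smaller on `I` than off `I`, then the angle at a vertex
`k ∉ I` of a triangle that meets `I` is small. -/
theorem IsPLMetric.eventually_innerAngle_conformal_lt {T : AbstractSimplicialComplex V}
    {d : Finset V → ℝ} (hd : IsPLMetric T d) {t : Finset V} (ht : t ∈ triangles T) {I : Finset V}
    (hI : (t ∩ I).Nonempty) {k : V} (hkt : k ∈ t) (hkI : k ∉ I) {ε : ℝ} (hε : 0 < ε) :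
    ∀ᶠ R : ℝ in atTop, ∀ w : V → ℝ, (∀ v, 0 < w v) → IsPLMetric T (conformal w d) →
      (∀ x ∈ I, ∀ y ∉ I, R * w x ≤ w y) → innerAngle (conformal w d) t k < ε := by
  obtain ⟨i, hi⟩ := hI
  obtain ⟨hit, hiI⟩ := Finset.mem_inter.1 hi
  have hik : i ≠ k := fun h => hkI (h ▸ hiI)
  obtain ⟨j, hij, hjk, rfl⟩ := exists_eq_triangle (mem_triangles.1 ht).2 hit hkt hik
  have e3 : ({i, j, k} : Finset V) = {k, i, j} := by grind
  have aij := hd.side_pos ht (by simp) (by simp) hij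
  have aik := hd.side_pos ht (by simp) (by simp) hik
  have ajk := hd.side_pos ht (by simp) (by simp) hjk
  filter_upwards [eventually_gt_atTop 0, eventually_gt_atTop ((d {i, k} + d {i, j}) / d {j, k}),
    eventually_arccos_lt (d {i, j} ^ 2 / (2 * d {j, k} * d {i, k})) hε] with R hR0 hR1 hR2
    w hw hPL hsep
  have hi0 := hw i
  have hj0 := hw j
  have hk0 := hw k
  have hRik := hsep i hiI k hkI
  -- If `j ∈ I`, the side `ij` is short compared with `ik` and `jk`, and `x² + y² ≥ 2xy` bounds the
  -- cosine at `k` below by `1 - C / R²`. If `j ∉ I`, the sides at `i` are both too short to satisfy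
  -- the triangle inequality against `jk`.
  by_cases hjI : j ∈ I
  · have hRjk := hsep j hjI k hkI
    refine lt_of_le_of_lt ?_ hR2
    rw [e3, innerAngle_eq _ hik.symm hjk.symm hij, Finset.pair_comm k i, Finset.pair_comm k j,
      conformal_pair _ _ hij, conformal_pair _ _ hik, conformal_pair _ _ hjk]
    refine Real.arccos_le_arccos ?_
    rw [div_div, le_div_iff₀ (by positivity), sub_mul, tsub_le_iff_right]
    have h1 : d {i, j} ^ 2 / (2 * d {j, k} * d {i, k} * R ^ 2) *
        (2 * (w j * w k * d {j, k} * (w i * w k * d {i, k}))) =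
        d {i, j} ^ 2 * (w i * w j) * w k ^ 2 / R ^ 2 := by
      field_simp
    have h2 : (w i * w j * d {i, j}) ^ 2 ≤ d {i, j} ^ 2 * (w i * w j) * w k ^ 2 / R ^ 2 := by
      rw [le_div_iff₀ (by positivity)]
      have : (R * w i) * (R * w j) ≤ w k * w k := by gcongr
      nlinarith [mul_le_mul_of_nonneg_left this
        (by positivity : 0 ≤ d {i, j} ^ 2 * (w i * w j))]
    rw [h1]
    nlinarith [sq_nonneg (w j * w k * d {j, k} - w i * w k * d {i, k})]
  · exfalso
    have hRij := hsep i hiI j hjI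
    have hlt := hPL.side_lt ht hij hik hjk
    rw [conformal_pair _ _ hij, conformal_pair _ _ hik, conformal_pair _ _ hjk] at hlt
    rw [div_lt_iff₀ ajk] at hR1
    have h1 : R * (w i * w k * d {i, k}) ≤ w j * w k * d {i, k} := by
      calc _ = (R * w i) * w k * d {i, k} := by ring
        _ ≤ _ := by gcongr
    have h2 : R * (w i * w j * d {i, j}) ≤ w j * w k * d {i, j} := by
      calc _ = (R * w i) * w j * d {i, j} := by ring
        _ ≤ w k * w j * d {i, j} := by gcongr
        _ = _ := by ring
    have h3 := mul_lt_mul_of_pos_left hR1 (mul_pos hj0 hk0)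
    have h4 := mul_lt_mul_of_pos_left hlt hR0
    linarith

theorem IsPLMetric.eventually_sum_curvature_conformal_lt {T : AbstractSimplicialComplex V}
    {d : Finset V → ℝ} (hd : IsPLMetric T d) (I : Finset V) {κ : ℝ}
    (hκ : degenerateCurvature T I < κ) :
    ∀ᶠ R : ℝ in atTop, ∀ w : V → ℝ, (∀ v, 0 < w v) → IsPLMetric T (conformal w d) →
      (∀ x ∈ I, ∀ y ∉ I, R * w x ≤ w y) → ∑ i ∈ I, curvature T (conformal w d) i < κ := by
  set n : ℝ := ((triangles T).card : ℝ)
  -- Each of the `n` triangles loses at most three angles smaller than `ε`.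
  obtain ⟨ε, hε, hεκ⟩ : ∃ ε : ℝ, 0 < ε ∧ degenerateCurvature T I + n * (3 * ε) < κ := by
    have hn : 0 ≤ n := Nat.cast_nonneg _
    refine ⟨(κ - degenerateCurvature T I) / (3 * (n + 1)),
      div_pos (sub_pos.2 hκ) (by positivity), ?_⟩
    have : n * (3 * ((κ - degenerateCurvature T I) / (3 * (n + 1)))) =
        (κ - degenerateCurvature T I) * (n / (n + 1)) := by field_simp
    rw [this]
    have : n / (n + 1) < 1 := (div_lt_one (by positivity)).2 (by linarith)
    nlinarith [sub_pos.2 hκ]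
  have key : ∀ᶠ R : ℝ in atTop, ∀ t ∈ triangles T, ∀ k ∈ t \ I, (t ∩ I).Nonempty →
      ∀ w : V → ℝ, (∀ v, 0 < w v) → IsPLMetric T (conformal w d) →
      (∀ x ∈ I, ∀ y ∉ I, R * w x ≤ w y) → innerAngle (conformal w d) t k < ε := by
    rw [Filter.eventually_all_finset]
    intro t ht
    rw [Filter.eventually_all_finset]
    intro k hk
    rw [Filter.eventually_imp_distrib_left]
    exact fun hI => hd.eventually_innerAngle_conformal_lt ht hI (Finset.mem_sdiff.1 hk).1
      (Finset.mem_sdiff.1 hk).2 hε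
  filter_upwards [key] with R hR w hw hPL hsep
  refine lt_of_le_of_lt ?_ hεκ
  rw [sum_curvature, degenerateCurvature, sub_add, ← nsmul_eq_mul, ← Finset.sum_const,
    ← Finset.sum_sub_distrib]
  refine sub_le_sub_left (Finset.sum_le_sum fun t ht => ?_) _
  split_ifs with h
  · rw [hPL.sum_inter_innerAngle ht]
    refine sub_le_sub_left ?_ _
    calc _ ≤ ∑ k ∈ t \ I, ε := Finset.sum_le_sum fun k hk => (hR t ht k hk h w hw hPL hsep).le
      _ = (t \ I).card * ε := by rw [Finset.sum_const, nsmul_eq_mul]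
      _ ≤ 3 * ε := by
        gcongr
        have := Finset.card_le_card (Finset.sdiff_subset (s := t) (t := I))
        rw [(mem_triangles.1 ht).2] at this
        exact_mod_cast this
  · have := Finset.sum_nonneg fun i (_ : i ∈ t ∩ I) => innerAngle_nonneg (conformal w d) t i
    linarith

/-! ### The flow -/

theorem not_developsEssentialSingularity {u : ℝ → V → ℝ} {L : EReal}
    (h : ∀ i, ∃ c : ℝ, ∀ t : ℝ, 0 ≤ t → (t : EReal) < L → 0 < u t i ∧ c ≤ Real.log (u t i)) :
    ¬ DevelopsEssentialSingularity u L := by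
  rintro ⟨i, τ, hτ, -, hlim⟩
  obtain ⟨c, hc⟩ := h i
  refine (Real.exp_pos c).not_ge (ge_of_tendsto' hlim fun n => ?_)
  obtain ⟨h1, h2⟩ := hc (τ n) (hτ n).1 (hτ n).2
  exact (Real.le_log_iff_exp_le h1).1 h2

theorem IsNormalizedFlow.hasDerivWithinAt_sum_log {T : AbstractSimplicialComplex V}
    {d : Finset V → ℝ} {L : EReal} {u : ℝ → V → ℝ} (hu : IsNormalizedFlow T d L u)
    (I : Finset V) {t : ℝ} (ht : 0 ≤ t) (htL : (t : EReal) < L) :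
    HasDerivWithinAt (fun s => ∑ i ∈ I, Real.log (u s i))
      (I.card * averageCurvature T - ∑ i ∈ I, curvature T (conformal (u t) d) i)
      (Set.Ici 0) t := by
  have h : ∀ i ∈ I, HasDerivWithinAt (fun s => Real.log (u s i))
      (averageCurvature T - curvature T (conformal (u t) d) i) (Set.Ici 0) t := by
    intro i _
    have hpos := hu.pos t ht htL i
    have := (hu.hasDeriv t ht htL i).log hpos.ne'
    convert this using 1
    field_simp
    ring
  have := HasDerivWithinAt.fun_sum h
  rwa [Finset.sum_sub_distrib, Finset.sum_const, nsmul_eq_mul] at this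

/-- Since `K_i ≤ 2π`, adding `(2π - K_av) t` to `log u_i` makes it nondecreasing. -/
theorem IsNormalizedFlow.neg_mul_le_log {T : AbstractSimplicialComplex V}
    {d : Finset V → ℝ} {L : EReal} {u : ℝ → V → ℝ} (hu : IsNormalizedFlow T d L u)
    {t : ℝ} (ht : 0 ≤ t) (htL : (t : EReal) < L) (i : V) :
    -((2 * Real.pi - averageCurvature T) * t) ≤ Real.log (u t i) := by
  have hL : ∀ s ∈ Set.Icc 0 t, (s : EReal) < L := fun s hs =>
    (EReal.coe_le_coe_iff.2 hs.2).trans_lt htL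
  have hder : ∀ s ∈ Set.Icc 0 t, HasDerivWithinAt
      (fun s => Real.log (u s i) + (2 * Real.pi - averageCurvature T) * s)
      (averageCurvature T - curvature T (conformal (u s) d) i +
        (2 * Real.pi - averageCurvature T)) (Set.Ici 0) s := by
    intro s hs
    have h1 := hu.hasDerivWithinAt_sum_log {i} hs.1 (hL s hs)
    simp only [Finset.sum_singleton, Finset.card_singleton, Nat.cast_one, one_mul] at h1
    have h2 : HasDerivWithinAt (fun s => (2 * Real.pi - averageCurvature T) * s)
        (2 * Real.pi - averageCurvature T) (Set.Ici 0) s := by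
      simpa using (hasDerivWithinAt_id s _).const_mul (2 * Real.pi - averageCurvature T)
    exact h1.fun_add h2
  have hmono : MonotoneOn
      (fun s => Real.log (u s i) + (2 * Real.pi - averageCurvature T) * s) (Set.Icc 0 t) := by
    refine monotoneOn_of_hasDerivWithinAt_nonneg (convex_Icc 0 t)
      (fun s hs => ((hder s hs).continuousWithinAt).mono Set.Icc_subset_Ici_self)
      (fun s hs => (hder s (interior_subset hs)).mono
        (interior_subset.trans Set.Icc_subset_Ici_self)) fun s _ => ?_
    have : 0 ≤ ∑ t ∈ (triangles T).filter (fun t => i ∈ t), innerAngle (conformal (u s) d) t i :=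
      Finset.sum_nonneg fun t _ => innerAngle_nonneg _ _ _
    rw [curvature]
    linarith
  have := hmono (Set.left_mem_Icc.2 ht) (Set.right_mem_Icc.2 ht) ht
  simp only [hu.initial, Real.log_one, mul_zero, add_zero] at this
  linarith

/-- A strictly convex, nonpositive function of the number `k` of vertices, which serves as a
barrier for the sums of `k` logarithms of conformal factors. -/
def barrier (N : ℕ) (r : ℝ) (k : ℕ) : ℝ := r / 2 * (k * (k - N))

theorem barrier_nonpos {N k : ℕ} {r : ℝ} (hr : 0 ≤ r) (hk : k ≤ N) : barrier N r k ≤ 0 := by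
  have : (k : ℝ) ≤ N := by exact_mod_cast hk
  exact mul_nonpos_of_nonneg_of_nonpos (by positivity)
    (mul_nonpos_of_nonneg_of_nonpos (by positivity) (by linarith))

theorem barrier_second_difference (N : ℕ) (r : ℝ) (k : ℕ) :
    barrier N r (k + 2) - barrier N r (k + 1) - (barrier N r (k + 1) - barrier N r k) = r := by
  simp only [barrier]
  push_cast
  ring

/-- A set of vertices that minimizes the sum of values minus the barrier is separated from its
complement by a gap in the values. -/
theorem le_sub_of_forall_sum_sub_barrier_le {x : V → ℝ} {N : ℕ} {r : ℝ} {I : Finset V}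
    (hI : ∀ J : Finset V, ∑ i ∈ I, x i - barrier N r I.card ≤ ∑ i ∈ J, x i - barrier N r J.card)
    {i j : V} (hi : i ∈ I) (hj : j ∉ I) : r ≤ x j - x i := by
  -- Removing `i` bounds `x i` above by one increment of the barrier; adding `j` bounds `x j` below
  -- by the next one.
  have h1 := hI (I.erase i)
  have h2 := hI (insert j I)
  rw [Finset.sum_insert hj, Finset.card_insert_of_notMem hj] at h2
  have hc := Finset.card_erase_add_one hi
  rw [← Finset.add_sum_erase I x hi] at h1 h2
  rw [← hc] at h1 h2
  have := barrier_second_difference N r (I.erase i).card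
  rw [add_assoc] at h2
  norm_num at h2
  linarith

/-- A function on a half-line with positive derivative at `s` takes smaller values before `s`. -/
theorem exists_lt_of_hasDerivWithinAt_pos {f : ℝ → ℝ} {f' s : ℝ} (hs : 0 < s)
    (hf : HasDerivWithinAt f f' (Set.Ici 0) s) (hf' : 0 < f') : ∃ r ∈ Set.Ioo 0 s, f r < f s := by
  have h := (hasDerivWithinAt_iff_tendsto_slope' (Set.self_notMem_Iio (a := s))).1
    (hf.hasDerivAt (Ici_mem_nhds hs)).hasDerivWithinAt
  have h0 : ∀ᶠ r in 𝓝[<] s, 0 < slope f s r := h.eventually_const_lt hf'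
  obtain ⟨r, hr, hr'⟩ := (h0.and (Ioo_mem_nhdsLT hs)).exists
  refine ⟨r, hr', ?_⟩
  rw [slope_comm, slope_def_field] at hr
  have := (div_pos_iff_of_pos_right (sub_pos.2 hr'.2)).1 hr
  linarith

/-- Along the flow on an admissible triangulation, the logarithms of the conformal factors are
bounded from below. -/
theorem IsNormalizedFlow.exists_barrier_le {T : AbstractSimplicialComplex V}
    (hT : IsClosedSurface T) (hadm : IsAdmissible T) {d : Finset V → ℝ} (hd : IsPLMetric T d)
    {u : ℝ → V → ℝ} (hu : IsNormalizedFlow T d ⊤ u) :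
    ∃ r : ℝ, ∀ t : ℝ, 0 ≤ t → ∀ I : Finset V,
      barrier (Fintype.card V) r I.card ≤ ∑ i ∈ I, Real.log (u t i) := by
  obtain ⟨d₀, hd₀, c, hc⟩ := hadm
  have hsum (I : Finset V) : ∑ i ∈ I, curvature T d₀ i = I.card * averageCurvature T := by
    rw [Finset.sum_congr rfl fun i _ => hd₀.curvature_eq_averageCurvature hT hc i,
      Finset.sum_const, nsmul_eq_mul]
  have hev : ∀ᶠ R : ℝ in atTop, ∀ I : Finset V,
      (∃ t ∈ triangles T, (t ∩ I).Nonempty ∧ (t \ I).Nonempty) →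
      ∀ w : V → ℝ, (∀ v, 0 < w v) → IsPLMetric T (conformal w d) →
      (∀ x ∈ I, ∀ y ∉ I, R * w x ≤ w y) →
        ∑ i ∈ I, curvature T (conformal w d) i < I.card * averageCurvature T := by
    rw [eventually_all]
    intro I
    rw [eventually_imp_distrib_left]
    intro hI
    exact hd.eventually_sum_curvature_conformal_lt I (hsum I ▸ hd₀.degenerateCurvature_lt hI)
  -- One `R` serves all of the finitely many `I`; `R ≥ 1` makes the barrier nonpositive, hence below
  -- the zero sums at time `0`.
  obtain ⟨R, hR, hR1⟩ := (hev.and (eventually_ge_atTop 1)).exists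
  have hRpos : 0 < R := by linarith
  refine ⟨Real.log R, fun t ht I₁ => ?_⟩
  set b := barrier (Fintype.card V) (Real.log R)
  have hb (I : Finset V) : b I.card ≤ 0 :=
    barrier_nonpos (Real.log_nonneg hR1) (Finset.card_le_univ I)
  have hder (I : Finset V) (s : ℝ) (hs : 0 ≤ s) :=
    hu.hasDerivWithinAt_sum_log I hs (EReal.coe_lt_top s)
  have hcont (I : Finset V) :
      ContinuousOn (fun s => ∑ i ∈ I, Real.log (u s i)) (Set.Icc 0 t) := fun s hs =>
    (hder I s hs.1).continuousWithinAt.mono Set.Icc_subset_Ici_self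
  by_contra! hlt
  choose m hm hmin using fun I =>
    isCompact_Icc.exists_isMinOn (Set.nonempty_Icc.2 ht) (hcont I)
  obtain ⟨I, -, hI⟩ := Finset.exists_min_image (Finset.univ : Finset (Finset V))
    (fun I => ∑ i ∈ I, Real.log (u (m I) i) - b I.card) ⟨∅, Finset.mem_univ _⟩
  set s := m I
  have hmin' (J : Finset V) (r : ℝ) (hr : r ∈ Set.Icc 0 t) :
      ∑ i ∈ I, Real.log (u s i) - b I.card ≤ ∑ i ∈ J, Real.log (u r i) - b J.card :=
    (hI J (Finset.mem_univ J)).trans (sub_le_sub_right (hmin J hr) _)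
  -- The minimum is negative because the barrier is violated at time `t`; so the minimizing time is
  -- positive and the sum over `I` is not constant.
  have hneg : ∑ i ∈ I, Real.log (u s i) < ∑ i ∈ I, Real.log (u 0 i) := by
    have h1 := hmin' I₁ t (Set.right_mem_Icc.2 ht)
    have h2 := hb I
    simp only [hu.initial, Real.log_one, Finset.sum_const_zero]
    linarith
  have hs0 : 0 < s := lt_of_le_of_ne (hm I).1 fun h => by
    rw [← h] at hneg
    exact lt_irrefl _ hneg
  by_cases hstr : ∃ t ∈ triangles T, (t ∩ I).Nonempty ∧ (t \ I).Nonempty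
  · have hpos := hu.pos s hs0.le (EReal.coe_lt_top s)
    have hK := hR I hstr (u s) hpos (hu.isPLMetric s hs0.le (EReal.coe_lt_top s))
      fun x hx y hy => by
        have := le_sub_of_forall_sum_sub_barrier_le (fun J => hmin' J s (hm I)) hx hy
        rw [← Real.log_le_log_iff (mul_pos hRpos (hpos x)) (hpos y),
          Real.log_mul hRpos.ne' (hpos x).ne']
        linarith
    -- Only earlier times are compared, as `s` may be the endpoint `t`.
    obtain ⟨r, hr, hrs⟩ := exists_lt_of_hasDerivWithinAt_pos hs0 (hder I s hs0.le) (sub_pos.2 hK)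
    exact hrs.not_ge (hmin I ⟨hr.1.le, hr.2.le.trans (hm I).2⟩)
  -- Without a straddling triangle, every PL metric has the same total curvature on `I`, namely `|I|
  -- K_av`, so the derivative vanishes.
  · refine hneg.ne (constant_of_has_deriv_right_zero (hcont I) (fun r hr => ?_) s (hm I))
    have h0 := (hder I r hr.1).mono (Set.Ici_subset_Ici.2 hr.1)
    rwa [(hu.isPLMetric r hr.1 (EReal.coe_lt_top r)).sum_curvature_eq hstr,
      ← hd₀.sum_curvature_eq hstr, hsum, sub_self] at h0

end Yamabe

end

theorem theorem1p3 {V : Type*} [Fintype V] [DecidableEq V] (T : AbstractSimplicialComplex V)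
    (hT : Yamabe.IsClosedSurface T) :
    (∀ d : Finset V → ℝ, Yamabe.IsPLMetric T d →
      ∀ (L : ℝ) (u : ℝ → V → ℝ), Yamabe.IsNormalizedFlow T d (L : EReal) u →
        ¬ Yamabe.DevelopsEssentialSingularity u (L : EReal)) ∧
    (Yamabe.IsAdmissible T →
      ∀ d : Finset V → ℝ, Yamabe.IsPLMetric T d →
        ∀ u : ℝ → V → ℝ, Yamabe.IsNormalizedFlow T d ⊤ u →
          ¬ Yamabe.DevelopsEssentialSingularity u ⊤) := by
  constructor
  · intro d _ L u hu
    refine Yamabe.not_developsEssentialSingularity fun i =>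
      -- The absolute value avoids determining the sign of `2π - K_av`.
      ⟨-(|2 * Real.pi - Yamabe.averageCurvature T| * L), fun t ht htL => ⟨hu.pos t ht htL i, ?_⟩⟩
    refine le_trans (neg_le_neg ?_) (hu.neg_mul_le_log ht htL i)
    exact mul_le_mul (le_abs_self _) (EReal.coe_lt_coe_iff.1 htL).le ht (abs_nonneg _)
  · intro hadm d hd u hu
    obtain ⟨r, hr⟩ := hu.exists_barrier_le hT hadm hd
    refine Yamabe.not_developsEssentialSingularity fun i =>
      ⟨Yamabe.barrier (Fintype.card V) r 1, fun t ht htL => ⟨hu.pos t ht htL i, ?_⟩⟩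
    simpa using hr t ht {i}
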